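/- Let $p\ge 5$ and let $m_0=1$, $m_1=p-2$, $m_{n+2}=(p-2)m_{n+1}-m_n$, and $M_n=\sum_{i=0}^n m_i$ ($M_{-1}=0$). The metallic code $[n]$ of a positive integer $n$ is the word $a_k\cdots a_0$ with $n=\sum_{i=0}^k a_i m_i$, $a_i\in\{0,\dots,p-3\}$, $a_k\neq 0$, which contains no factor $\mathbf d\mathbf c^{j}\mathbf d$ ($j\ge 0$), where $\mathbf d=p-3$, $\mathbf c=p-4$. A $\mathbf 0$-node is a positive integer whose code ends in $0$; let $\mathcal T$ be the set of $\mathbf 0$-nodes, and for $\tau\in\mathcal T$ let $\varphi(\tau)$ be the number represented by the word obtained from $[\tau]$ by erasing its last digit. The white metallic tree $\mathcal W$ has the positive integers as nodes, with root $1$ and with levels $\mathcal L_n=\{M_{n-1}+1,\dots,M_n\}$. An assignment is a map $\alpha=(\alpha_\ell,\alpha_b,\alpha_s)$ on the nodes with $\alpha_s(\nu)\in\{0,1\}$ (status; $0$ white, $1$ black), $\alpha_s(1)=0$, $\alpha_\ell(\nu)\in\mathcal L_{n+1}$ for $\nu\in\mathcal L_n$, $\alpha_\ell(\nu+1)=\alpha_\ell(\nu)+p-2-\alpha_s(\nu)$,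 $\alpha_\ell(M_n)=M_{n+1}-p+3+\alpha_s(M_n)$, $\alpha_b(\nu)\in\{1,\dots,p-2-\alpha_s(\nu)\}$, and such that exactly one of the sons $\alpha_\ell(\nu),\alpha_\ell(\nu)+1,\dots,\alpha_\ell(\nu+1)-1$ of $\nu$ is black, namely the one in position $\alpha_b(\nu)$. Write $\mathcal W_\alpha$ for the resulting tree. Given $\alpha$, make $\mathcal T$ a tree as follows. Its root is the node with code $\mathbf{10}$; the sons of $\tau\in\mathcal T$ are the $\mathbf 0$-nodes lying on level $2$ of the subtree of $\mathcal W_\alpha$ rooted at the father $\mu$ of $\tau$ in $\mathcal W_\alpha$; the status of $\tau$ in $\mathcal T$ is $\alpha_s(\mu)$. Nodes on a level are ordered from left to right as integers, and the natural numbering of a tree numbers its nodes from $1$ (the root), level by level and from left to right. Theorem. For every assignment $\alpha$: the map $\varphi$, $[\nu]\mathbf 0\mapsto\nu$, is a bijection from $\mathcal T$ onto the set of nodes of $\mathcal W$, $[\tau]=[\varphi(\tau)]\mathbf 0$ for all $\tau\in\mathcal T$, and the father of $\tau$ in $\mathcal W_\alpha$ is $\varphi(\tau)$. Both $\mathcal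 W_\alpha$ and $\mathcal T$ are infinite, finitely branching, planar rooted trees in whose natural numbering the sons of each node have consecutive numbers, and the natural number of the node $\nu$ of $\mathcal W_\alpha$ is $\nu$. The map $\varphi$ is an isomorphism from $\mathcal T$ onto $\mathcal W_\alpha$: it preserves the root, the son relation, the natural numbers, the levels and the numbers of sons. It transports $\alpha$: the status of $\tau$ in $\mathcal T$ is $\alpha_s(\varphi(\tau))$, and each of the trees $\mathcal W_\alpha$ and $\mathcal T$, with its own sons and statuses, obeys $\alpha$, that is, the node with natural number $n$ has status $\alpha_s(n)$, its leftmost son has number $\alpha_\ell(n)$, it has $p-2-\alpha_s(n)$ sons, and exactly one of them is black, in position $\alpha_b(n)$. -/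

import Mathlib

namespace Metallic

/-! ### Metallic numbers and metallic codes -/

/-- The white metallic sequence `m 0 = 1`, `m 1 = p - 2`, `m (n+2) = (p-2) m (n+1) - m n`.
For `p ≥ 5` the subtraction never truncates, see `m_le_m_succ`. -/
def m (p : ℕ) : ℕ → ℕ
  | 0 => 1
  | 1 => p - 2
  | n + 2 => (p - 2) * m p (n + 1) - m p n

theorem m_le_m_succ (p : ℕ) (hp : 5 ≤ p) (n : ℕ) : m p n ≤ m p (n + 1) := by
  induction n with
  | zero => simp only [m]; omega
  | succ k ih =>
    have h3 : 3 * m p (k + 1) ≤ (p - 2) * m p (k + 1) :=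
      Nat.mul_le_mul_right _ (by omega)
    have h : m p (k + 1 + 1) = (p - 2) * m p (k + 1) - m p k := by simp only [m]
    omega

/-- The number of nodes of the white metallic tree on the levels `< n`. The number usually
written `M_n` (nodes on the levels `0, …, n`) is `nodesBelow p (n + 1)`. -/
def nodesBelow (p n : ℕ) : ℕ := ∑ i ∈ Finset.range n, m p i

/-- The level `n` of the white metallic tree, in its natural numbering: `M_{n-1} < ν ≤ M_n`. -/
def levelSet (p n : ℕ) : Set ℕ := Set.Ioc (nodesBelow p n) (nodesBelow p (n + 1))

/-- The number represented by a metallic word. A word `a_k … a_1 a_0` is the list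
`[a_0, a_1, …, a_k]`, lowest digit first; so the word `w` followed by the digit `0`
is the list `0 :: w`. -/
def value (p : ℕ) (w : List ℕ) : ℕ := ∑ i ∈ Finset.range w.length, w.getD i 0 * m p i

/-- The word contains a pattern `d c … c d` with `d = p - 3` and `k ≥ 0` digits `c = p - 4`. -/
def HasForbiddenPattern (p : ℕ) (w : List ℕ) : Prop :=
  ∃ k : ℕ, ((p - 3) :: (List.replicate k (p - 4) ++ [p - 3])) <:+: w

/-- `w` is a metallic code of `n`: digits in `{0, …, p-3}`, nonzero leading digit, no forbidden
pattern, and value `n`. -/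
structure IsCode (p : ℕ) (w : List ℕ) (n : ℕ) : Prop where
  digit_le : ∀ a ∈ w, a ≤ p - 3
  leading : w.getLast? ≠ some 0
  allowed : ¬ HasForbiddenPattern p w
  value_eq : value p w = n

open Classical in
/-- The metallic code `[n]` of `n`. -/
noncomputable def code (p n : ℕ) : List ℕ :=
  if h : ∃ w : List ℕ, IsCode p w n then h.choose else []

/-- The `0`-nodes: positive integers whose signature (lowest digit of the code) is `0`. -/
def zeroNodes (p : ℕ) : Set ℕ := {τ | 1 ≤ τ ∧ (code p τ).head? = some 0}

/-- The map `[ν]0 ↦ ν`: erase the lowest digit of the code and restore the number. -/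
noncomputable def phi (p τ : ℕ) : ℕ := value p (code p τ).tail

/-! ### Numbered trees -/

/-- `PathOfLength son k μ ν`: there is a path `μ = λ_0, …, λ_k = ν` from father to son. -/
def PathOfLength (son : ℕ → ℕ → Prop) : ℕ → ℕ → ℕ → Prop
  | 0, μ, ν => μ = ν
  | k + 1, μ, ν => ∃ κ, PathOfLength son k μ κ ∧ son κ ν

/-- A set of integers with a root and a relation "`IsSon μ ν`: the node `ν` is a son of `μ`".
The left-to-right order on the nodes of a level is the order of the integers. -/
structure OrderedTree where
  nodes : Set ℕ
  root : ℕ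
  IsSon : ℕ → ℕ → Prop

namespace OrderedTree

def sons (T : OrderedTree) (ν : ℕ) : Set ℕ := {κ | T.IsSon ν κ}

/-- The distance of a node from the root. -/
noncomputable def level (T : OrderedTree) (ν : ℕ) : ℕ :=
  sInf {k | PathOfLength T.IsSon k T.root ν}

/-- The natural numbering: `1` for the root, then level by level, from left to right. -/
noncomputable def number (T : OrderedTree) (ν : ℕ) : ℕ :=
  Set.ncard {μ | μ ∈ T.nodes ∧
    (T.level μ < T.level ν ∨ (T.level μ = T.level ν ∧ μ ≤ ν))}

/-- `T` is an infinite, finitely branching, planar rooted tree in whose natural numbering the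
sons of each node have consecutive numbers. -/
structure IsNumberedTree (T : OrderedTree) : Prop where
  infinite : T.nodes.Infinite
  root_mem : T.root ∈ T.nodes
  son_mem : ∀ μ ν, T.IsSon μ ν → μ ∈ T.nodes ∧ ν ∈ T.nodes
  root_not_son : ∀ μ, ¬ T.IsSon μ T.root
  existsUnique_father : ∀ ν ∈ T.nodes, ν ≠ T.root → ∃! μ, T.IsSon μ ν
  reachable : ∀ ν ∈ T.nodes, ∃ k, PathOfLength T.IsSon k T.root ν
  finite_sons : ∀ ν ∈ T.nodes, (T.sons ν).Finite
  planar : ∀ μ ∈ T.nodes, ∀ ν ∈ T.nodes, T.level μ = T.level ν → μ < ν →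
    ∀ κ ∈ T.sons μ, ∀ η ∈ T.sons ν, κ < η
  consecutive : ∀ ν ∈ T.nodes, ∃ a : ℕ,
    T.number '' T.sons ν = Set.Ico a (a + (T.sons ν).ncard)

/-- `f` is an isomorphism of numbered trees from `S` onto `T`: it is a bijection which respects
the root, the son relation, the natural numbers, the levels and the numbers of sons. -/
structure IsIso (f : ℕ → ℕ) (S T : OrderedTree) : Prop where
  bijOn : Set.BijOn f S.nodes T.nodes
  map_root : f S.root = T.root
  isSon_iff : ∀ μ ∈ S.nodes, ∀ ν ∈ S.nodes, S.IsSon μ ν ↔ T.IsSon (f μ) (f ν)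
  number_eq : ∀ ν ∈ S.nodes, T.number (f ν) = S.number ν
  level_eq : ∀ ν ∈ S.nodes, T.level (f ν) = S.level ν
  ncard_sons_eq : ∀ ν ∈ S.nodes, (T.sons (f ν)).ncard = (S.sons ν).ncard

end OrderedTree

/-! ### Assignments -/

/-- An assignment on the white metallic tree, whose nodes are the integers `ν ≥ 1`:
`l ν` is the leftmost son of `ν`, `b ν ≥ 1` is the position of the black son among the sons
of `ν`, and `s ν` is the numerical status of `ν`: `0` for white, `1` for black. -/
structure Assignment (p : ℕ) where
  l : ℕ → ℕ
  b : ℕ → ℕ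
  s : ℕ → ℕ
  s_root : s 1 = 0
  l_mem : ∀ n, ∀ ν ∈ levelSet p n, l ν ∈ levelSet p (n + 1)
  s_mem : ∀ ν, 1 ≤ ν → s ν = 0 ∨ s ν = 1
  b_mem : ∀ ν, 1 ≤ ν → 1 ≤ b ν ∧ b ν ≤ p - 2 - s ν
  sum_s : ∀ ν, 1 ≤ ν → ∑ κ ∈ Finset.Ico (l ν) (l (ν + 1)), s κ = 1
  s_black : ∀ ν, 1 ≤ ν → s (l ν + b ν - 1) = 1
  l_succ : ∀ ν, 1 ≤ ν → l (ν + 1) = l ν + (p - 2 - s ν)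
  l_last : ∀ n, l (nodesBelow p (n + 1)) + p =
    nodesBelow p (n + 2) + 3 + s (nodesBelow p (n + 1))

namespace Assignment

variable {p : ℕ}

/-- `ν` is a son of `μ` under `α`. -/
def IsSon (α : Assignment p) (μ ν : ℕ) : Prop :=
  1 ≤ μ ∧ α.l μ ≤ ν ∧ ν < α.l μ + (p - 2 - α.s μ)

/-- The white metallic tree equipped with `α`. -/
def whiteTree (α : Assignment p) : OrderedTree where
  nodes := {ν | 1 ≤ ν}
  root := 1
  IsSon := α.IsSon

/-- The father of `ν` under `α`, for `ν ≥ 2`. -/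
noncomputable def father (α : Assignment p) (ν : ℕ) : ℕ := sInf {μ | α.IsSon μ ν}

/-- The tree structure on the set of `0`-nodes. Its root is the node with code `10`. The sons of
a `0`-node `τ` are the `0`-nodes on the level `2` of the subtree rooted at the father of `τ`. -/
noncomputable def zeroTree (α : Assignment p) : OrderedTree where
  nodes := zeroNodes p
  root := value p [0, 1]
  IsSon := fun τ τ' => τ ∈ zeroNodes p ∧ τ' ∈ zeroNodes p ∧
    PathOfLength α.IsSon 2 (α.father τ) τ'

/-- The status of a `0`-node in the tree of the `0`-nodes is the status of its father. -/
noncomputable def zeroStatus (α : Assignment p) (τ : ℕ) : ℕ := α.s (α.father τ)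

end Assignment

/-- In the numbered tree `T` with statuses `st`, the statuses, the leftmost sons, the numbers of
sons and the positions of the black sons are those prescribed by the assignment `α`, where each
node is referred to by its number in the natural numbering of `T`. -/
structure OrderedTree.Carries {p : ℕ} (T : OrderedTree) (st : ℕ → ℕ) (α : Assignment p) :
    Prop where
  status : ∀ ν ∈ T.nodes, st ν = α.s (T.number ν)
  leftmost : ∀ ν ∈ T.nodes, IsLeast (T.number '' T.sons ν) (α.l (T.number ν))
  ncard_sons : ∀ ν ∈ T.nodes, (T.sons ν).ncard = p - 2 - α.s (T.number ν)
  existsUnique_black : ∀ ν ∈ T.nodes, ∃! β, β ∈ T.sons ν ∧ st β = 1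
  black_position : ∀ ν ∈ T.nodes, ∀ β ∈ T.sons ν, st β = 1 →
    {κ | κ ∈ T.sons ν ∧ κ ≤ β}.ncard = α.b (T.number ν)

end Metallic

namespace Metallic

/-! ### The metallic sequence -/

/-! The heart is `isSon_zeroNode`: whatever the assignment, the node with code `[ν]0` is a son of
`ν`. Write `Z` for this node and `B` for the number of black nodes below `ν`. Counting sons gives `l
ν = (p-2)ν + 4 - p - B` (`l_add_sum_s`), while the recurrence of `m`, applied digit by digit, gives
`Z + φ(ν) = (p-2)ν` (`zeroNode_add_phi`). Hence `Z - l ν = B + p - 4 - φ(ν)`, and it remains to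
compare `B` with `φ(ν)`. Every node has exactly one black son, so `B` is `μ - 1` or `μ`, where `μ`
is the father of `ν` (`sum_s_Ico_l`, `sum_s_add_le`). By strong induction the 0-nodes of `μ - 1` and
`μ + 1` lie among their sons and so enclose `ν`; as `φ` is monotone (`phi_mono`), `μ - 1 ≤ φ(ν) ≤
μ`. These bounds are exactly sufficient. Thus the father of a 0-node `τ` is `φ(τ)`, and `φ` is a
monotone bijection onto the positive integers. A 0-node on level 2 below `φ(τ)` is one whose father
`φ(τ')` is a son of `φ(τ)`, so `φ` respects sons. All remaining notions depend only on order, root,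
sons and statuses, and are transported by `IsMonotoneIso`. -/

theorem m_pos (p : ℕ) (hp : 5 ≤ p) (n : ℕ) : 1 ≤ m p n := by
  induction n with
  | zero => simp [m]
  | succ k ih => exact ih.trans (m_le_m_succ p hp k)

theorem m_mono (p : ℕ) (hp : 5 ≤ p) : Monotone (m p) :=
  monotone_nat_of_le_succ (m_le_m_succ p hp)

theorem m_add_two (p : ℕ) (hp : 5 ≤ p) (n : ℕ) :
    m p (n + 2) + m p n = (p - 2) * m p (n + 1) := by
  have h1 := m_le_m_succ p hp n
  have h2 : 1 * m p (n + 1) ≤ (p - 2) * m p (n + 1) := Nat.mul_le_mul_right _ (by omega)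
  have h3 : m p (n + 2) = (p - 2) * m p (n + 1) - m p n := rfl
  omega

theorem lt_m (p : ℕ) (hp : 5 ≤ p) (n : ℕ) : n < m p n := by
  induction n with
  | zero => simp [m]
  | succ k ih =>
    cases k with
    | zero => simp only [m]; omega
    | succ j =>
      have h1 := m_le_m_succ p hp j
      have h2 := m_add_two p hp j
      have h3 : 3 * m p (j + 1) ≤ (p - 2) * m p (j + 1) := Nat.mul_le_mul_right _ (by omega)
      show j + 1 + 1 < m p (j + 2)
      omega

/-! ### Values of words -/

@[simp] theorem value_nil (p : ℕ) : value p [] = 0 := by simp [value]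

theorem value_append_singleton (p : ℕ) (w : List ℕ) (a : ℕ) :
    value p (w ++ [a]) = value p w + a * m p w.length := by
  simp only [value, List.length_append, List.length_singleton, Finset.sum_range_succ]
  congr 1
  · refine Finset.sum_congr rfl fun i hi => ?_
    rw [List.getD_append _ _ _ _ (Finset.mem_range.1 hi)]
  · rw [List.getD_append_right _ _ _ _ le_rfl]; simp

theorem value_cons (p a : ℕ) (w : List ℕ) : value p (a :: w) = a + value p (0 :: w) := by
  simp only [value, List.length_cons, Finset.sum_range_succ']
  simp [m, add_comm]

theorem value_append_replicate_zero (p : ℕ) (w : List ℕ) (k : ℕ) :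
    value p (w ++ List.replicate k 0) = value p w := by
  induction k with
  | zero => simp
  | succ k ih =>
    rw [List.replicate_succ', ← List.append_assoc, value_append_singleton, ih]; simp

/-- This is the recurrence summed over the digits: shifting up turns `m i` into `m (i+1)`, erasing
the last digit turns it into `m (i-1)`. For the lowest digit `m 1 = p - 2`, and the erased term
plays the role of `m (-1) = 0`. -/
theorem value_zero_cons_add_value_tail (p : ℕ) (hp : 5 ≤ p) (w : List ℕ) :
    value p (0 :: w) + value p w.tail = (p - 2) * value p w := by
  induction w using List.reverseRecOn with
  | nil => simp [value]
  | append_singleton w a ih =>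
    cases w with
    | nil => simp [value, Finset.sum_range_succ, m, mul_comm]
    | cons b w =>
      have h1 := m_add_two p hp w.length
      rw [← List.cons_append, value_append_singleton, value_append_singleton, List.cons_append,
        List.tail_cons, value_append_singleton, mul_add]
      simp only [List.tail_cons, List.length_cons] at ih ⊢
      have h2 : a * m p (w.length + 1 + 1) + a * m p w.length
          = (p - 2) * (a * m p (w.length + 1)) := by
        rw [← mul_add, h1]; ring
      omega

/-! ### Admissible words -/

/-- The word has a leading part `c … c d`, so that it cannot be preceded by the digit `d`. -/
def EndsBlocked (p : ℕ) (w : List ℕ) : Prop :=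
  ∃ k : ℕ, ((p - 3) :: List.replicate k (p - 4)) <:+ w

/-- A word with digits in `{0, …, p-3}` and without a forbidden pattern. -/
structure Admissible (p : ℕ) (w : List ℕ) : Prop where
  digit_le : ∀ a ∈ w, a ≤ p - 3
  allowed : ¬ HasForbiddenPattern p w

theorem not_endsBlocked_nil (p : ℕ) : ¬ EndsBlocked p [] := by
  rintro ⟨k, h⟩
  simp at h

/-- Words are stored lowest digit first, so appending adds a new leading digit. The inductions on
words run over leading digits, with blockedness as the only memory needed. -/
theorem endsBlocked_append_singleton {p : ℕ} {w : List ℕ} {a : ℕ} :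
    EndsBlocked p (w ++ [a]) ↔ a = p - 3 ∨ a = p - 4 ∧ EndsBlocked p w := by
  constructor
  · rintro ⟨k, t, h⟩
    cases k with
    | zero =>
      have := List.append_inj_right' h rfl
      simp at this
      exact Or.inl this.symm
    | succ k =>
      rw [List.replicate_succ', ← List.cons_append, ← List.append_assoc] at h
      have h1 := List.append_inj_right' h rfl
      have h2 := List.append_inj_left' h rfl
      simp at h1
      exact Or.inr ⟨h1.symm, k, t, h2⟩
  · rintro (rfl | ⟨rfl, k, t, h⟩)
    · exact ⟨0, w, rfl⟩
    · refine ⟨k + 1, t, ?_⟩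
      rw [List.replicate_succ', ← List.cons_append, ← List.append_assoc, h]

theorem hasForbiddenPattern_append_singleton {p : ℕ} {w : List ℕ} {a : ℕ} :
    HasForbiddenPattern p (w ++ [a]) ↔
      HasForbiddenPattern p w ∨ a = p - 3 ∧ EndsBlocked p w := by
  constructor
  · rintro ⟨k, s, t, h⟩
    rcases List.eq_nil_or_concat t with rfl | ⟨t, b, rfl⟩
    · rw [List.append_nil, ← List.cons_append, ← List.append_assoc] at h
      have h1 := List.append_inj_right' h rfl
      have h2 := List.append_inj_left' h rfl
      simp at h1
      exact Or.inr ⟨h1.symm, k, s, h2⟩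
    · rw [List.concat_eq_append, ← List.append_assoc] at h
      exact Or.inl ⟨k, s, t, List.append_inj_left' h rfl⟩
  · rintro (⟨k, s, t, h⟩ | ⟨rfl, k, s, h⟩)
    · exact ⟨k, s, t ++ [a], by rw [← List.append_assoc, h]⟩
    · exact ⟨k, s, [], by rw [List.append_nil, ← List.cons_append, ← List.append_assoc, h]⟩

theorem admissible_nil (p : ℕ) : Admissible p [] :=
  ⟨by simp, by rintro ⟨k, h⟩; simp at h⟩

theorem admissible_append_singleton {p : ℕ} {w : List ℕ} {a : ℕ} :
    Admissible p (w ++ [a]) ↔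
      Admissible p w ∧ a ≤ p - 3 ∧ (a = p - 3 → ¬ EndsBlocked p w) := by
  constructor
  · rintro ⟨h1, h2⟩
    rw [hasForbiddenPattern_append_singleton] at h2
    exact ⟨⟨fun b hb => h1 b (by simp [hb]), fun h => h2 (Or.inl h)⟩, h1 a (by simp),
      fun h h' => h2 (Or.inr ⟨h, h'⟩)⟩
  · rintro ⟨⟨h1, h2⟩, h3, h4⟩
    refine ⟨fun b hb => ?_, ?_⟩
    · rcases List.mem_append.1 hb with hb | hb
      · exact h1 b hb
      · rw [List.mem_singleton.1 hb]; exact h3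
    · rw [hasForbiddenPattern_append_singleton]
      rintro (h | ⟨h, h'⟩)
      · exact h2 h
      · exact h4 h h'

theorem Admissible.append_replicate_zero {p : ℕ} (hp : 5 ≤ p) {w : List ℕ}
    (h : Admissible p w) (k : ℕ) : Admissible p (w ++ List.replicate k 0) := by
  induction k with
  | zero => simpa using h
  | succ k ih =>
    rw [List.replicate_succ', ← List.append_assoc, admissible_append_singleton]
    exact ⟨ih, Nat.zero_le _, fun h => by omega⟩

theorem Admissible.tail {p : ℕ} {w : List ℕ} (h : Admissible p w) : Admissible p w.tail := by
  refine ⟨fun a ha => h.digit_le a (List.mem_of_mem_tail ha), ?_⟩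
  rintro ⟨k, hk⟩
  exact h.allowed ⟨k, hk.trans (List.tail_suffix w).isInfix⟩

theorem Admissible.zero_cons {p : ℕ} (hp : 5 ≤ p) {w : List ℕ} (h : Admissible p w) :
    Admissible p (0 :: w) := by
  refine ⟨fun a ha => ?_, ?_⟩
  · rcases List.mem_cons.1 ha with rfl | ha
    · exact Nat.zero_le _
    · exact h.digit_le a ha
  · rintro ⟨k, hk⟩
    rcases List.infix_cons_iff.1 hk with hk | hk
    · rw [List.cons_prefix_cons] at hk
      omega
    · exact h.allowed ⟨k, hk⟩

/-- An admissible word of length `n` has a value less than `m n`, and less than `m n - m (n-1)`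
if it can be preceded by the digit `d`. -/
theorem Admissible.value_bounds {p : ℕ} (hp : 5 ≤ p) {w : List ℕ} (h : Admissible p w) :
    value p w < m p w.length ∧
      (¬ EndsBlocked p w → ∀ n, w.length = n + 1 → value p w + m p n < m p (n + 1)) := by
  induction w using List.reverseRecOn with
  | nil => simp [m]
  | append_singleton w a ih =>
    rw [admissible_append_singleton] at h
    obtain ⟨h1, h2, h3⟩ := h
    obtain ⟨i1, i2⟩ := ih h1
    rw [value_append_singleton, endsBlocked_append_singleton]
    simp only [List.length_append, List.length_singleton, Nat.add_right_cancel_iff, forall_eq']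
    generalize hl : w.length = n at *
    obtain ⟨q, rfl⟩ : ∃ q, p = q + 5 := ⟨p - 5, by omega⟩
    cases n with
    | zero =>
      obtain rfl : w = [] := List.length_eq_zero_iff.1 hl
      have := not_endsBlocked_nil (q + 5)
      simp only [m, value_nil]
      refine ⟨by omega, fun h => ?_⟩
      rw [not_or] at h
      omega
    | succ n =>
      have hr := m_add_two (q + 5) hp n
      have hm := m_le_m_succ (q + 5) hp n
      have e : q + 5 - 2 = q + 3 := by omega
      rw [e] at hr
      have key : ∀ b, a ≤ b → a * m (q + 5) (n + 1) ≤ b * m (q + 5) (n + 1) :=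
        fun b hb => Nat.mul_le_mul_right _ hb
      have e3 : q + 5 - 3 = q + 2 := by omega
      have e4 : q + 5 - 4 = q + 1 := by omega
      rw [e3] at h2 h3 ⊢
      rw [e4]
      constructor
      · rcases h2.lt_or_eq with h | h
        -- For `a ≤ c` the value is below `(p-3) * m (n+1)`, which is at most `m (n+2)` because `m n
        -- ≤ m (n+1)`.
        · have := key (q + 1) (by omega)
          nlinarith
        -- For `a = d` the rest is unblocked, and its sharper bound `m (n+1) - m n` supplies exactly
        -- the `- m n` of the recurrence.
        · have := i2 (h3 h) n rfl
          subst h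
          nlinarith
      · intro hb
        rw [not_or] at hb
        by_cases h : a = q + 1
        · have := i2 (fun h' => hb.2 ⟨h, h'⟩) n rfl
          subst h
          nlinarith
        · have := key q (by omega)
          nlinarith

theorem Admissible.value_lt {p : ℕ} (hp : 5 ≤ p) {w : List ℕ} (h : Admissible p w) :
    value p w < m p w.length := (h.value_bounds hp).1

/-- Converse of `Admissible.value_bounds`, by Euclidean division by `m k` to obtain the leading
digit. Both ranges must be treated together, since the remainder under a digit `d` has to be
unblocked. The length is prescribed, so leading zeros are allowed. -/
theorem exists_admissible {p : ℕ} (hp : 5 ≤ p) (k : ℕ) :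
    (∀ n < m p k, ∃ w, Admissible p w ∧ w.length = k ∧ value p w = n) ∧
    (∀ n j, k = j + 1 → n + m p j < m p k →
      ∃ w, Admissible p w ∧ w.length = k ∧ value p w = n ∧ ¬ EndsBlocked p w) := by
  induction k with
  | zero =>
    refine ⟨fun n hn => ⟨[], admissible_nil p, rfl, ?_⟩, fun n j h => by omega⟩
    simp only [m] at hn
    simp; omega
  | succ k ih =>
    obtain ⟨i1, i2⟩ := ih
    have hpos := m_pos p hp k
    have hmod : ∀ n, n % m p k < m p k := fun n => Nat.mod_lt _ hpos
    have hdiv : ∀ n, n % m p k + n / m p k * m p k = n := fun n => by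
      rw [mul_comm]; exact Nat.mod_add_div n _
    obtain ⟨q, rfl⟩ : ∃ q, p = q + 5 := ⟨p - 5, by omega⟩
    have e3 : q + 5 - 3 = q + 2 := by omega
    have e4 : q + 5 - 4 = q + 1 := by omega
    -- the remainder of a number with leading digit `d`, or `c`, can be preceded by `d`
    have build : ∀ b < m (q + 5) k,
        (∀ j, k = j + 1 → b + m (q + 5) j < m (q + 5) k) →
        ∃ w, Admissible (q + 5) w ∧ w.length = k ∧ value (q + 5) w = b ∧
          ¬ EndsBlocked (q + 5) w := by
      intro b hb hj
      cases k with
      | zero =>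
        refine ⟨[], admissible_nil _, rfl, ?_, not_endsBlocked_nil _⟩
        simp only [m] at hb
        simp; omega
      | succ j => exact i2 b j rfl (hj j rfl)
    have hle : ∀ n, n < m (q + 5) (k + 1) → n / m (q + 5) k ≤ q + 2 := by
      intro n hn
      rw [← Nat.lt_succ_iff, Nat.div_lt_iff_lt_mul hpos]
      cases k with
      | zero => simp only [m] at *; omega
      | succ j =>
        have := m_add_two (q + 5) hp j
        have e : q + 5 - 2 = q + 3 := by omega
        rw [e] at this
        show n < (q + 3) * _
        have e' : m (q + 5) (j + 1 + 1) = m (q + 5) (j + 2) := rfl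
        omega
    constructor
    · intro n hn
      have ha := hle n hn
      have hd := hdiv n
      have hm := hmod n
      generalize n / m (q + 5) k = a at *
      generalize n % m (q + 5) k = b at *
      by_cases h : a = q + 2
      -- With quotient `d`, the bound `n < m (j+2)` and the recurrence leave `b + m j < m (j+1)`,
      -- the range of unblocked words.
      · obtain ⟨w, w1, w2, w3, w4⟩ := build b hm (by
          rintro j rfl
          have := m_add_two (q + 5) hp j
          have e : q + 5 - 2 = q + 3 := by omega
          rw [e] at this
          subst h
          nlinarith)
        exact ⟨w ++ [a], admissible_append_singleton.2 ⟨w1, by omega, fun _ => w4⟩, by simp [w2],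
          by rw [value_append_singleton, w2, w3]; omega⟩
      · obtain ⟨w, w1, w2, w3⟩ := i1 b hm
        exact ⟨w ++ [a], admissible_append_singleton.2 ⟨w1, by omega, fun _ => by omega⟩,
          by simp [w2], by rw [value_append_singleton, w2, w3]; omega⟩
    · intro n j hj hn
      obtain rfl : k = j := by omega
      -- Adding `m k` raises the quotient by one and still gives a number below `m (k+1)`, so the
      -- digit `d` is excluded.
      have ha : n / m (q + 5) k ≤ q + 1 := by
        have h1 := hle (n + m (q + 5) k) hn
        rw [Nat.add_div_right _ hpos] at h1
        omega
      have hd := hdiv n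
      have hm := hmod n
      generalize n / m (q + 5) k = a at *
      generalize n % m (q + 5) k = b at *
      by_cases h : a = q + 1
      · obtain ⟨w, w1, w2, w3, w4⟩ := build b hm (by
          rintro j rfl
          have := m_add_two (q + 5) hp j
          have e : q + 5 - 2 = q + 3 := by omega
          rw [e] at this
          subst h
          nlinarith)
        refine ⟨w ++ [a], admissible_append_singleton.2 ⟨w1, by omega, fun _ => w4⟩, by simp [w2],
          by rw [value_append_singleton, w2, w3]; omega, ?_⟩
        rw [endsBlocked_append_singleton]
        rintro (h' | ⟨-, h'⟩)
        · omega
        · exact w4 h'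
      · obtain ⟨w, w1, w2, w3⟩ := i1 b hm
        refine ⟨w ++ [a], admissible_append_singleton.2 ⟨w1, by omega, fun _ => by omega⟩,
          by simp [w2], by rw [value_append_singleton, w2, w3]; omega, ?_⟩
        rw [endsBlocked_append_singleton]
        omega

/-- On admissible words of a given length, erasing the lowest digit is monotone for the values. -/
theorem Admissible.value_tail_le {p : ℕ} (hp : 5 ≤ p) {u w : List ℕ} (hu : Admissible p u)
    (hw : Admissible p w) (hl : u.length = w.length) (hv : value p u ≤ value p w) :
    value p u.tail ≤ value p w.tail := by
  induction u using List.reverseRecOn generalizing w with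
  | nil => simp
  | append_singleton u a ih =>
    rcases List.eq_nil_or_concat w with rfl | ⟨w, b, rfl⟩
    · simp at hl
    rw [List.concat_eq_append] at *
    have hl' : u.length = w.length := by simpa using hl
    rw [value_append_singleton, value_append_singleton, hl'] at hv
    have hu' := (admissible_append_singleton.1 hu).1
    have hw' := (admissible_append_singleton.1 hw).1
    have hab : a ≤ b := by
      by_contra h
      have h1 := hw'.value_lt hp
      have h2 : (b + 1) * m p w.length ≤ a * m p w.length := Nat.mul_le_mul_right _ (by omega)
      rw [add_mul] at h2
      omega
    cases u with
    | nil =>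
      obtain rfl : w = [] := List.length_eq_zero_iff.1 hl'.symm
      simp
    | cons x u =>
      cases w with
      | nil => simp at hl'
      | cons y w =>
        have hl'' : u.length = w.length := by simpa using hl'
        simp only [List.cons_append, List.tail_cons, value_append_singleton, hl'']
        rcases hab.lt_or_eq with h | rfl
        -- The leading digits still decide after the erasure, since the shortened lower part stays
        -- below one unit of the leading place.
        · have h1 := hu'.tail.value_lt hp
          have h2 : (a + 1) * m p w.length ≤ b * m p w.length := Nat.mul_le_mul_right _ h
          rw [add_mul] at h2
          simp only [List.tail_cons, hl''] at h1
          omega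
        · have := ih hu' hw' hl' (by omega)
          simpa using this

/-- Monotonicity of erasure in both directions gives tails of equal value; after induction on the
tails only the lowest digits are left to compare. -/
theorem Admissible.eq_of_value_eq {p : ℕ} (hp : 5 ≤ p) {u w : List ℕ} (hu : Admissible p u)
    (hw : Admissible p w) (hl : u.length = w.length) (hv : value p u = value p w) : u = w := by
  induction u generalizing w with
  | nil => exact (List.length_eq_zero_iff.1 hl.symm).symm
  | cons a u ih =>
    cases w with
    | nil => simp at hl
    | cons b w =>
      have h1 : value p u = value p w :=
        le_antisymm (hu.value_tail_le hp hw hl hv.le) (hw.value_tail_le hp hu hl.symm hv.ge)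
      obtain rfl := ih hu.tail hw.tail (by simpa using hl) h1
      rw [value_cons, value_cons p b] at hv
      rw [Nat.add_right_cancel hv]

/-! ### Existence and uniqueness of the metallic code -/

theorem IsCode.admissible {p n : ℕ} {w : List ℕ} (h : IsCode p w n) : Admissible p w :=
  ⟨h.digit_le, h.allowed⟩

theorem exists_isCode {p : ℕ} (hp : 5 ≤ p) (n : ℕ) : ∃ w, IsCode p w n := by
  have hex : ∃ k, ∃ w, Admissible p w ∧ w.length = k ∧ value p w = n :=
    ⟨n, (exists_admissible hp n).1 n (lt_m p hp n)⟩
  classical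
  obtain ⟨w, h1, h2, h3⟩ := Nat.find_spec hex
  refine ⟨w, h1.digit_le, fun h => ?_, h1.allowed, h3⟩
  rcases List.eq_nil_or_concat w with rfl | ⟨u, b, rfl⟩
  · simp at h
  rw [List.concat_eq_append] at *
  obtain rfl : b = 0 := by simpa using h
  rw [value_append_singleton] at h3
  -- The word has minimal length among admissible words of value `n`; a leading zero could be
  -- dropped.
  refine Nat.find_min hex (m := u.length) ?_
    ⟨u, (admissible_append_singleton.1 h1).1, rfl, by omega⟩
  rw [← h2]; simp

theorem IsCode.m_le {p n : ℕ} {w : List ℕ} (h : IsCode p w n) {k : ℕ} (hk : w.length = k + 1) :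
    m p k ≤ n := by
  rcases List.eq_nil_or_concat w with rfl | ⟨u, b, rfl⟩
  · simp at hk
  have hb := h.leading
  have hv := h.value_eq
  rw [List.concat_eq_append] at *
  obtain rfl : u.length = k := by simpa using hk
  have hb' : 1 ≤ b := by
    rw [Nat.one_le_iff_ne_zero]; rintro rfl; simp at hb
  rw [value_append_singleton] at hv
  have : 1 * m p u.length ≤ b * m p u.length := Nat.mul_le_mul_right _ hb'
  omega

/-- A code of length `k + 1` has its value in `[m k, m (k+1))`, so the value determines the length.
-/
theorem IsCode.length_le {p : ℕ} (hp : 5 ≤ p) {n n' : ℕ} {u w : List ℕ} (hu : IsCode p u n)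
    (hw : IsCode p w n') (h : n ≤ n') : u.length ≤ w.length := by
  by_contra! hl
  obtain ⟨k, hk⟩ : ∃ k, u.length = k + 1 := ⟨u.length - 1, by omega⟩
  have h1 := hu.m_le hk
  have h2 := hw.admissible.value_lt hp
  rw [hw.value_eq] at h2
  have h3 := m_mono p hp (show w.length ≤ k by omega)
  omega

theorem IsCode.unique {p : ℕ} (hp : 5 ≤ p) {n : ℕ} {u w : List ℕ} (hu : IsCode p u n)
    (hw : IsCode p w n) : u = w :=
  hu.admissible.eq_of_value_eq hp hw.admissible
    (le_antisymm (hu.length_le hp hw le_rfl) (hw.length_le hp hu le_rfl))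
    (hu.value_eq.trans hw.value_eq.symm)

theorem isCode_code {p : ℕ} (hp : 5 ≤ p) (n : ℕ) : IsCode p (code p n) n := by
  have h := exists_isCode hp n
  rw [code, dif_pos h]
  exact h.choose_spec

theorem IsCode.code_eq {p : ℕ} (hp : 5 ≤ p) {n : ℕ} {w : List ℕ} (h : IsCode p w n) :
    code p n = w := (isCode_code hp n).unique hp h

theorem code_zero {p : ℕ} (hp : 5 ≤ p) : code p 0 = [] :=
  IsCode.code_eq hp ⟨by simp, by simp, (admissible_nil p).allowed, by simp⟩

theorem code_one {p : ℕ} (hp : 5 ≤ p) : code p 1 = [1] := by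
  have h : Admissible p ([] ++ [1]) := admissible_append_singleton.2
    ⟨admissible_nil p, by omega, fun _ => not_endsBlocked_nil p⟩
  exact IsCode.code_eq hp ⟨h.digit_le, by simp, h.allowed, by simp [value, m]⟩

theorem phi_one {p : ℕ} (hp : 5 ≤ p) : phi p 1 = 0 := by
  simp [phi, code_one hp]

theorem code_ne_nil {p : ℕ} (hp : 5 ≤ p) {n : ℕ} (hn : 1 ≤ n) : code p n ≠ [] := by
  intro h
  have := (isCode_code hp n).value_eq
  rw [h, value_nil] at this
  omega

theorem IsCode.tail {p n : ℕ} {w : List ℕ} (h : IsCode p w n) :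
    IsCode p w.tail (value p w.tail) := by
  refine ⟨h.admissible.tail.digit_le, fun h' => h.leading ?_, h.admissible.tail.allowed, rfl⟩
  cases w with
  | nil => simp at h'
  | cons a w =>
    cases w with
    | nil => simp at h'
    | cons b w => simpa [List.getLast?_cons_cons] using h'

/-- The empty word, which is the code of `0`, is excluded because the word `0` has a zero leading
digit. -/
theorem IsCode.zero_cons {p : ℕ} (hp : 5 ≤ p) {n : ℕ} {w : List ℕ} (h : IsCode p w n)
    (hw : w ≠ []) : IsCode p (0 :: w) (value p (0 :: w)) := by
  have h1 := h.admissible.zero_cons hp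
  refine ⟨h1.digit_le, fun h' => h.leading ?_, h1.allowed, rfl⟩
  cases w with
  | nil => exact absurd rfl hw
  | cons b w => simpa [List.getLast?_cons_cons] using h'

/-! ### The `0`-nodes -/

/-- The number with code `[n]0`. -/
noncomputable def zeroNode (p n : ℕ) : ℕ := value p (0 :: code p n)

theorem code_zeroNode {p : ℕ} (hp : 5 ≤ p) {n : ℕ} (hn : 1 ≤ n) :
    code p (zeroNode p n) = 0 :: code p n :=
  ((isCode_code hp n).zero_cons hp (code_ne_nil hp hn)).code_eq hp

theorem code_phi {p : ℕ} (hp : 5 ≤ p) (n : ℕ) : code p (phi p n) = (code p n).tail :=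
  (isCode_code hp n).tail.code_eq hp

theorem zeroNode_add_phi {p : ℕ} (hp : 5 ≤ p) (n : ℕ) :
    zeroNode p n + phi p n = (p - 2) * n := by
  have := value_zero_cons_add_value_tail p hp (code p n)
  rwa [(isCode_code hp n).value_eq] at this

theorem phi_zeroNode {p : ℕ} (hp : 5 ≤ p) {n : ℕ} (hn : 1 ≤ n) : phi p (zeroNode p n) = n := by
  rw [phi, code_zeroNode hp hn, List.tail_cons, (isCode_code hp n).value_eq]

theorem zeroNode_phi_le {p : ℕ} (hp : 5 ≤ p) (n : ℕ) : zeroNode p (phi p n) ≤ n := by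
  rw [zeroNode, code_phi hp]
  conv_rhs => rw [← (isCode_code hp n).value_eq]
  cases code p n with
  | nil => simp [value]
  | cons a w => rw [value_cons p a]; exact Nat.le_add_left _ _

theorem phi_mono {p : ℕ} (hp : 5 ≤ p) : Monotone (phi p) := by
  intro n n' h
  have hn := isCode_code hp n
  have hn' := isCode_code hp n'
  have hl := hn.length_le hp hn' h
  unfold phi
  rcases Nat.eq_zero_or_pos n with rfl | h0
  · rw [code_zero hp]; simp
  have hne := code_ne_nil hp h0
  -- Leading zeros bring the two codes to the same length, as `Admissible.value_tail_le` requires.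
  have h1 := (hn.admissible.append_replicate_zero hp
    ((code p n').length - (code p n).length)).value_tail_le hp hn'.admissible (by simp; omega)
    (by rw [value_append_replicate_zero, hn.value_eq, hn'.value_eq]; exact h)
  rwa [List.tail_append_of_ne_nil hne, value_append_replicate_zero] at h1

theorem zeroNode_strictMono {p : ℕ} (hp : 5 ≤ p) {μ ν : ℕ} (hμ : 1 ≤ μ) (h : μ < ν) :
    zeroNode p μ < zeroNode p ν := by
  by_contra! hle
  have := phi_mono hp hle
  rw [phi_zeroNode hp hμ, phi_zeroNode hp (by omega)] at this
  omega

theorem zeroNode_mem {p : ℕ} (hp : 5 ≤ p) {n : ℕ} (hn : 1 ≤ n) :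
    zeroNode p n ∈ zeroNodes p := by
  refine ⟨?_, by rw [code_zeroNode hp hn]; rfl⟩
  rw [Nat.one_le_iff_ne_zero]
  intro h
  have := code_zeroNode hp hn
  rw [h, code_zero hp] at this
  simp at this

theorem code_eq_zero_cons {p : ℕ} (hp : 5 ≤ p) {τ : ℕ} (hτ : τ ∈ zeroNodes p) :
    code p τ = 0 :: code p (phi p τ) := by
  rw [code_phi hp]
  have := hτ.2
  cases h : code p τ with
  | nil => simp [h] at this
  | cons a w =>
    rw [h] at this
    simp at this
    simp [this]

theorem zeroNode_phi {p : ℕ} (hp : 5 ≤ p) {τ : ℕ} (hτ : τ ∈ zeroNodes p) :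
    zeroNode p (phi p τ) = τ := by
  rw [zeroNode, ← code_eq_zero_cons hp hτ, (isCode_code hp τ).value_eq]

theorem one_le_phi {p : ℕ} (hp : 5 ≤ p) {τ : ℕ} (hτ : τ ∈ zeroNodes p) : 1 ≤ phi p τ := by
  rw [Nat.one_le_iff_ne_zero]
  intro h
  have h1 := code_eq_zero_cons hp hτ
  have h2 := (isCode_code hp τ).leading
  rw [h, code_zero hp] at h1
  simp [h1] at h2

theorem phi_bijOn {p : ℕ} (hp : 5 ≤ p) : Set.BijOn (phi p) (zeroNodes p) {ν : ℕ | 1 ≤ ν} := by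
  refine ⟨fun τ hτ => one_le_phi hp hτ, fun τ hτ τ' hτ' h => ?_, fun ν hν => ?_⟩
  · rw [← zeroNode_phi hp hτ, ← zeroNode_phi hp hτ', h]
  · exact ⟨zeroNode p ν, zeroNode_mem hp hν, phi_zeroNode hp hν⟩

theorem phi_strictMonoOn {p : ℕ} (hp : 5 ≤ p) : StrictMonoOn (phi p) (zeroNodes p) :=
  ((phi_mono hp).monotoneOn _).strictMonoOn_of_injOn (phi_bijOn hp).injOn


/-! ### Transport of numbered trees along monotone bijections -/

namespace OrderedTree

/-- A monotone bijection between the nodes of two trees, respecting the root and the sons. -/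
structure IsMonotoneIso (f : ℕ → ℕ) (S T : OrderedTree) : Prop where
  bijOn : Set.BijOn f S.nodes T.nodes
  strictMonoOn : StrictMonoOn f S.nodes
  root_mem : S.root ∈ S.nodes
  map_root : f S.root = T.root
  son_mem : ∀ μ ν, S.IsSon μ ν → μ ∈ S.nodes ∧ ν ∈ S.nodes
  son_mem' : ∀ μ ν, T.IsSon μ ν → μ ∈ T.nodes ∧ ν ∈ T.nodes
  isSon_iff : ∀ μ ∈ S.nodes, ∀ ν ∈ S.nodes, S.IsSon μ ν ↔ T.IsSon (f μ) (f ν)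

namespace IsMonotoneIso

variable {f : ℕ → ℕ} {S T : OrderedTree}

theorem pathOfLength_iff (h : IsMonotoneIso f S T) {μ : ℕ} (hμ : μ ∈ S.nodes) (k : ℕ) :
    ∀ ν ∈ S.nodes, PathOfLength S.IsSon k μ ν ↔ PathOfLength T.IsSon k (f μ) (f ν) := by
  induction k with
  | zero => exact fun ν hν => (h.bijOn.injOn.eq_iff hμ hν).symm
  | succ k ih =>
    intro ν hν
    constructor
    · rintro ⟨κ, h1, h2⟩
      have hκ := (h.son_mem _ _ h2).1
      exact ⟨f κ, (ih κ hκ).1 h1, (h.isSon_iff κ hκ ν hν).1 h2⟩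
    · rintro ⟨κ, h1, h2⟩
      obtain ⟨κ, hκ, rfl⟩ := h.bijOn.surjOn (h.son_mem' _ _ h2).1
      exact ⟨κ, (ih κ hκ).2 h1, (h.isSon_iff κ hκ ν hν).2 h2⟩

theorem level_eq (h : IsMonotoneIso f S T) {ν : ℕ} (hν : ν ∈ S.nodes) :
    T.level (f ν) = S.level ν := by
  simp only [level, ← h.map_root, ← h.pathOfLength_iff h.root_mem _ ν hν]

/-- Levels are preserved and so is the order inside each level, hence `f` maps the set counted by
one number onto the set counted by the other. -/
theorem number_eq (h : IsMonotoneIso f S T) {ν : ℕ} (hν : ν ∈ S.nodes) :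
    T.number (f ν) = S.number ν := by
  unfold number
  have hinj : Set.InjOn f {μ | μ ∈ S.nodes ∧
      (S.level μ < S.level ν ∨ (S.level μ = S.level ν ∧ μ ≤ ν))} :=
    h.bijOn.injOn.mono fun _ hμ => hμ.1
  rw [← hinj.ncard_image]
  congr 1
  ext κ
  constructor
  · rintro ⟨h1, h2⟩
    obtain ⟨μ, hμ, rfl⟩ := h.bijOn.surjOn h1
    rw [h.level_eq hμ, h.level_eq hν, h.strictMonoOn.le_iff_le hμ hν] at h2
    exact ⟨μ, ⟨hμ, h2⟩, rfl⟩
  · rintro ⟨μ, ⟨hμ, h2⟩, rfl⟩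
    refine ⟨h.bijOn.mapsTo hμ, ?_⟩
    rwa [h.level_eq hμ, h.level_eq hν, h.strictMonoOn.le_iff_le hμ hν]

theorem sons_subset (h : IsMonotoneIso f S T) (ν : ℕ) : S.sons ν ⊆ S.nodes :=
  fun _ hκ => (h.son_mem _ _ hκ).2

theorem image_sons (h : IsMonotoneIso f S T) {ν : ℕ} (hν : ν ∈ S.nodes) :
    f '' S.sons ν = T.sons (f ν) := by
  ext κ
  constructor
  · rintro ⟨μ, hμ, rfl⟩
    exact (h.isSon_iff ν hν μ (h.sons_subset ν hμ)).1 hμ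
  · intro hκ
    obtain ⟨μ, hμ, rfl⟩ := h.bijOn.surjOn (h.son_mem' _ _ hκ).2
    exact ⟨μ, (h.isSon_iff ν hν μ hμ).2 hκ, rfl⟩

theorem ncard_sons_eq (h : IsMonotoneIso f S T) {ν : ℕ} (hν : ν ∈ S.nodes) :
    (T.sons (f ν)).ncard = (S.sons ν).ncard := by
  rw [← h.image_sons hν, (h.bijOn.injOn.mono (h.sons_subset ν)).ncard_image]

theorem number_image_sons (h : IsMonotoneIso f S T) {ν : ℕ} (hν : ν ∈ S.nodes) :
    T.number '' T.sons (f ν) = S.number '' S.sons ν := by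
  rw [← h.image_sons hν, Set.image_image]
  exact Set.image_congr fun κ hκ => h.number_eq (h.sons_subset ν hκ)

theorem isIso (h : IsMonotoneIso f S T) : IsIso f S T where
  bijOn := h.bijOn
  map_root := h.map_root
  isSon_iff := h.isSon_iff
  number_eq _ := h.number_eq
  level_eq _ := h.level_eq
  ncard_sons_eq _ := h.ncard_sons_eq

theorem isNumberedTree (h : IsMonotoneIso f S T) (hT : T.IsNumberedTree) :
    S.IsNumberedTree where
  infinite := by
    refine Set.Infinite.of_image f ?_
    rw [h.bijOn.image_eq]
    exact hT.infinite
  root_mem := h.root_mem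
  son_mem := h.son_mem
  root_not_son μ hμ := hT.root_not_son (f μ) (by
    rw [← h.map_root]
    exact (h.isSon_iff _ (h.son_mem _ _ hμ).1 _ h.root_mem).1 hμ)
  existsUnique_father ν hν hne := by
    obtain ⟨κ, h1, h2⟩ := hT.existsUnique_father (f ν) (h.bijOn.mapsTo hν) fun h' =>
      hne (h.bijOn.injOn hν h.root_mem (h'.trans h.map_root.symm))
    obtain ⟨μ, hμ, rfl⟩ := h.bijOn.surjOn (h.son_mem' _ _ h1).1
    refine ⟨μ, (h.isSon_iff μ hμ ν hν).2 h1, fun μ' hμ' => ?_⟩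
    have hm := (h.son_mem _ _ hμ').1
    exact h.bijOn.injOn hm hμ (h2 _ ((h.isSon_iff μ' hm ν hν).1 hμ'))
  reachable ν hν := by
    obtain ⟨k, hk⟩ := hT.reachable (f ν) (h.bijOn.mapsTo hν)
    rw [← h.map_root] at hk
    exact ⟨k, (h.pathOfLength_iff h.root_mem k ν hν).2 hk⟩
  finite_sons ν hν := by
    refine Set.Finite.of_finite_image ?_ (h.bijOn.injOn.mono (h.sons_subset ν))
    rw [h.image_sons hν]
    exact hT.finite_sons _ (h.bijOn.mapsTo hν)
  planar μ hμ ν hν hl hlt κ hκ η hη := by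
    rw [← h.level_eq hμ, ← h.level_eq hν] at hl
    refine (h.strictMonoOn.lt_iff_lt (h.sons_subset _ hκ) (h.sons_subset _ hη)).1 ?_
    refine hT.planar _ (h.bijOn.mapsTo hμ) _ (h.bijOn.mapsTo hν) hl (h.strictMonoOn hμ hν hlt)
      _ ?_ _ ?_
    · rw [← h.image_sons hμ]; exact Set.mem_image_of_mem f hκ
    · rw [← h.image_sons hν]; exact Set.mem_image_of_mem f hη
  consecutive ν hν := by
    obtain ⟨a, ha⟩ := hT.consecutive (f ν) (h.bijOn.mapsTo hν)
    exact ⟨a, by rw [← h.number_image_sons hν, ha, h.ncard_sons_eq hν]⟩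

theorem carries (h : IsMonotoneIso f S T) {p : ℕ} {α : Assignment p} {st st' : ℕ → ℕ}
    (hst : ∀ ν ∈ S.nodes, st' ν = st (f ν)) (hT : T.Carries st α) : S.Carries st' α where
  status ν hν := by rw [hst ν hν, hT.status _ (h.bijOn.mapsTo hν), h.number_eq hν]
  leftmost ν hν := by
    rw [← h.number_image_sons hν, ← h.number_eq hν]
    exact hT.leftmost _ (h.bijOn.mapsTo hν)
  ncard_sons ν hν := by
    rw [← h.ncard_sons_eq hν, ← h.number_eq hν]
    exact hT.ncard_sons _ (h.bijOn.mapsTo hν)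
  existsUnique_black ν hν := by
    obtain ⟨β, ⟨h1, h2⟩, h3⟩ := hT.existsUnique_black _ (h.bijOn.mapsTo hν)
    rw [← h.image_sons hν] at h1
    obtain ⟨κ, hκ, rfl⟩ := h1
    have hκ' := h.sons_subset ν hκ
    refine ⟨κ, ⟨hκ, by rw [hst κ hκ', h2]⟩, ?_⟩
    rintro η ⟨hη, hs⟩
    have hη' := h.sons_subset ν hη
    rw [hst η hη'] at hs
    exact h.bijOn.injOn hη' hκ'
      (h3 _ ⟨by rw [← h.image_sons hν]; exact Set.mem_image_of_mem f hη, hs⟩)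
  black_position ν hν β hβ hs := by
    have hβ' := h.sons_subset ν hβ
    rw [hst β hβ'] at hs
    have hinj : Set.InjOn f {κ | κ ∈ S.sons ν ∧ κ ≤ β} :=
      h.bijOn.injOn.mono fun κ hκ => h.sons_subset ν hκ.1
    rw [← h.number_eq hν, ← hT.black_position _ (h.bijOn.mapsTo hν) (f β)
      (by rw [← h.image_sons hν]; exact Set.mem_image_of_mem f hβ) hs,
      ← hinj.ncard_image, ← h.image_sons hν]
    congr 1
    ext κ
    constructor
    · rintro ⟨κ, ⟨hκ, hle⟩, rfl⟩
      exact ⟨Set.mem_image_of_mem f hκ,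
        (h.strictMonoOn.le_iff_le (h.sons_subset ν hκ) hβ').2 hle⟩
    · rintro ⟨⟨κ, hκ, rfl⟩, hle⟩
      exact ⟨κ, ⟨hκ, (h.strictMonoOn.le_iff_le (h.sons_subset ν hκ) hβ').1 hle⟩, rfl⟩

end IsMonotoneIso

end OrderedTree

/-! ### Fathers and sons in the white metallic tree -/

namespace Assignment

variable {p : ℕ}

theorem s_le_one (α : Assignment p) {ν : ℕ} (hν : 1 ≤ ν) : α.s ν ≤ 1 := by
  have := α.s_mem ν hν
  omega

theorem l_one (α : Assignment p) (hp : 5 ≤ p) : α.l 1 = 2 := by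
  have := α.l_last 0
  simp [nodesBelow, Finset.sum_range_succ, m, α.s_root] at this
  omega

theorem l_add_two_le (α : Assignment p) (hp : 5 ≤ p) {ν : ℕ} (hν : 1 ≤ ν) :
    α.l ν + 2 ≤ α.l (ν + 1) := by
  have h1 := α.l_succ ν hν
  have h2 := α.s_le_one hν
  omega

/-- Every node has at least `p - 3 ≥ 2` sons. This makes fathers smaller than their sons, which
drives the inductions on nodes. -/
theorem two_mul_le_l (α : Assignment p) (hp : 5 ≤ p) {ν : ℕ} (hν : 1 ≤ ν) : 2 * ν ≤ α.l ν := by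
  induction ν, hν using Nat.le_induction with
  | base => rw [α.l_one hp]
  | succ ν hν ih =>
    have := α.l_add_two_le hp hν
    omega

theorem l_mono (α : Assignment p) (hp : 5 ≤ p) {μ ν : ℕ} (hμ : 1 ≤ μ) (h : μ ≤ ν) :
    α.l μ ≤ α.l ν := by
  induction ν, h using Nat.le_induction with
  | base => exact le_rfl
  | succ ν hν ih =>
    have := α.l_add_two_le hp (hμ.trans hν)
    omega

/-- In this form the sets of sons are visibly consecutive intervals, which tile the integers from `l
1 = 2` on. -/
theorem isSon_iff (α : Assignment p) {μ ν : ℕ} :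
    α.IsSon μ ν ↔ 1 ≤ μ ∧ α.l μ ≤ ν ∧ ν < α.l (μ + 1) := by
  unfold IsSon
  constructor
  · rintro ⟨h1, h2, h3⟩
    exact ⟨h1, h2, by rwa [α.l_succ μ h1]⟩
  · rintro ⟨h1, h2, h3⟩
    exact ⟨h1, h2, by rwa [α.l_succ μ h1] at h3⟩

theorem IsSon.lt {α : Assignment p} (hp : 5 ≤ p) {μ ν : ℕ} (h : α.IsSon μ ν) : μ < ν := by
  have := α.two_mul_le_l hp h.1
  have := h.1
  have := h.2.1
  omega

theorem IsSon.father_le {α : Assignment p} (hp : 5 ≤ p) {μ μ' ν ν' : ℕ} (h : α.IsSon μ ν)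
    (h' : α.IsSon μ' ν') (hle : ν ≤ ν') : μ ≤ μ' := by
  by_contra! hlt
  have h1 := (α.isSon_iff.1 h').2.2
  have h2 := h.2.1
  have h3 := α.l_mono hp (Nat.le_add_left 1 μ') hlt
  omega

theorem exists_father (α : Assignment p) (hp : 5 ≤ p) {ν : ℕ} (hν : 2 ≤ ν) :
    ∃ μ, α.IsSon μ ν := by
  have hex : ∃ μ, ν < α.l (μ + 1) := by
    refine ⟨ν, ?_⟩
    have := α.two_mul_le_l hp (Nat.le_add_left 1 ν)
    omega
  classical
  have h1 := Nat.find_spec hex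
  have h0 : Nat.find hex ≠ 0 := by
    intro h0
    rw [h0, Nat.zero_add, α.l_one hp] at h1
    omega
  refine ⟨Nat.find hex, α.isSon_iff.2 ⟨Nat.one_le_iff_ne_zero.2 h0, ?_, h1⟩⟩
  have h2 := Nat.find_min hex (Nat.sub_lt (Nat.pos_of_ne_zero h0) one_pos)
  rw [Nat.sub_add_cancel (Nat.one_le_iff_ne_zero.2 h0)] at h2
  omega

theorem IsSon.eq_father {α : Assignment p} (hp : 5 ≤ p) {μ ν : ℕ} (h : α.IsSon μ ν) :
    α.father ν = μ := by
  have h1 : α.IsSon (α.father ν) ν := Nat.sInf_mem (s := {μ | α.IsSon μ ν}) ⟨μ, h⟩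
  exact le_antisymm (h1.father_le hp h le_rfl) (h.father_le hp h1 le_rfl)

/-! ### Counting the black nodes -/

/-- The nodes from `2` to `l μ - 1` are the sons of `1, …, μ - 1`, with one black node for each
father; the root is white. -/
theorem sum_s_Ico_l (α : Assignment p) (hp : 5 ≤ p) {μ : ℕ} (hμ : 1 ≤ μ) :
    ∑ κ ∈ Finset.Ico 1 (α.l μ), α.s κ + 1 = μ := by
  induction μ, hμ using Nat.le_induction with
  | base => simp [α.l_one hp, α.s_root]
  | succ μ hμ ih =>
    have h1 := α.two_mul_le_l hp hμ
    have h2 := α.l_add_two_le hp hμ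
    rw [← Finset.sum_Ico_consecutive α.s (show 1 ≤ α.l μ by omega)
      (show α.l μ ≤ α.l (μ + 1) by omega), α.sum_s μ hμ]
    omega

/-- Starting from `l 1 = 2`, each node before `ν` contributes `p - 2` sons, less one if it is black.
-/
theorem l_add_sum_s (α : Assignment p) (hp : 5 ≤ p) {ν : ℕ} (hν : 1 ≤ ν) :
    α.l ν + ∑ κ ∈ Finset.Ico 1 ν, α.s κ + p = (p - 2) * ν + 4 := by
  induction ν, hν using Nat.le_induction with
  | base => simp [α.l_one hp]; omega
  | succ ν hν ih =>
    rw [Finset.sum_Ico_succ_top hν, α.l_succ ν hν, mul_add]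
    have := α.s_le_one hν
    omega

theorem sum_s_add_le (α : Assignment p) {μ ν : ℕ} (h : α.IsSon μ ν) :
    ∑ κ ∈ Finset.Ico (α.l μ) ν, α.s κ + α.s ν ≤ 1 := by
  obtain ⟨h1, h2, h3⟩ := α.isSon_iff.1 h
  rw [← Finset.sum_Ico_succ_top h2]
  exact (Finset.sum_le_sum_of_subset
    (Finset.Ico_subset_Ico le_rfl (Nat.succ_le_of_lt h3))).trans (α.sum_s μ h1).le

/-- The node with code `[ν]0` is a son of `ν`. -/
theorem isSon_zeroNode (α : Assignment p) (hp : 5 ≤ p) {ν : ℕ} (hν : 1 ≤ ν) :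
    α.IsSon ν (zeroNode p ν) := by
  induction ν using Nat.strong_induction_on with
  | _ ν ih =>
  have hl := α.l_add_sum_s hp hν
  have hz := zeroNode_add_phi hp ν
  have hs := α.s_le_one hν
  have hls := α.l_succ ν hν
  rw [α.isSon_iff]
  refine ⟨hν, ?_⟩
  rcases hν.eq_or_lt with rfl | h2
  · rw [phi_one hp] at hz
    simp at hl
    have := α.s_root
    omega
  obtain ⟨μ, hμ⟩ := α.exists_father hp h2
  have hlt := hμ.lt hp
  have hμ1 := hμ.1
  -- With `B` the number of black nodes below `ν`, the goal amounts to `φ(ν) ≤ B + p - 4` and `B + s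
  -- ν ≤ φ(ν) + 1`. Here `μ - 1 ≤ B` and `B + s ν ≤ μ`, so `μ - 1 ≤ φ(ν) ≤ μ` suffices.
  have hB := α.sum_s_Ico_l hp hμ1
  have hC := α.sum_s_add_le hμ
  have hsum := Finset.sum_Ico_consecutive α.s
    (show 1 ≤ α.l μ by have := α.two_mul_le_l hp hμ1; omega) hμ.2.1
  have hup : phi p ν ≤ μ := by
    by_cases hcase : μ + 1 = ν
    · -- then `μ = 1` and `ν = 2`
      have h3 := α.two_mul_le_l hp hμ1
      have h4 := hμ.2.1
      obtain rfl : μ = 1 := by omega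
      have h5 := (ih 1 hlt le_rfl).2.1
      rw [α.l_one hp] at h5
      have h6 := phi_mono hp (show ν ≤ zeroNode p 1 by omega)
      rwa [phi_zeroNode hp le_rfl] at h6
    -- The 0-node of `μ + 1` lies to the right of all sons of `μ`, hence of `ν`, whereas `[φ(ν)]0`
    -- is at most `ν`.
    · have h3 := (ih (μ + 1) (by omega) (by omega)).2.1
      have h4 := (α.isSon_iff.1 hμ).2.2
      by_contra! h5
      have h6 := zeroNode_phi_le hp ν
      have h7 : zeroNode p (μ + 1) ≤ zeroNode p (phi p ν) := by
        rcases (Nat.succ_le_of_lt h5).eq_or_lt with h | h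
        · exact (congrArg _ h).le
        · exact (zeroNode_strictMono hp (by omega) h).le
      omega
  have hlow : μ ≤ phi p ν + 1 := by
    rcases hμ1.eq_or_lt with rfl | h3
    · omega
    -- The 0-node of `μ - 1` lies to the left of `l μ`, hence of `ν`; then `φ` is applied to both.
    · have h4 := (α.isSon_iff.1 (ih (μ - 1) (by omega) (by omega))).2.2
      rw [Nat.sub_add_cancel hμ1] at h4
      have h5 := phi_mono hp (show zeroNode p (μ - 1) ≤ ν by have := hμ.2.1; omega)
      rw [phi_zeroNode hp (by omega)] at h5
      omega
  omega

theorem father_eq_phi (α : Assignment p) (hp : 5 ≤ p) {τ : ℕ} (hτ : τ ∈ zeroNodes p) :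
    α.IsSon (phi p τ) τ ∧ α.father τ = phi p τ := by
  have h := α.isSon_zeroNode hp (one_le_phi hp hτ)
  rw [zeroNode_phi hp hτ] at h
  exact ⟨h, h.eq_father hp⟩

/-! ### The white metallic tree -/

theorem whiteTree_sons (α : Assignment p) {ν : ℕ} (hν : 1 ≤ ν) :
    α.whiteTree.sons ν = Set.Ico (α.l ν) (α.l ν + (p - 2 - α.s ν)) := by
  ext κ
  exact ⟨fun h => h.2, fun h => ⟨hν, h⟩⟩

theorem reachable (α : Assignment p) (hp : 5 ≤ p) {ν : ℕ} (hν : 1 ≤ ν) :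
    ∃ k, PathOfLength α.IsSon k 1 ν := by
  induction ν using Nat.strong_induction_on with
  | _ ν ih =>
  rcases hν.eq_or_lt with rfl | h2
  · exact ⟨0, rfl⟩
  · obtain ⟨μ, hμ⟩ := α.exists_father hp h2
    obtain ⟨k, hk⟩ := ih μ (hμ.lt hp) hμ.1
    exact ⟨k + 1, μ, hk, hμ⟩

theorem one_lt_of_isSon (α : Assignment p) (hp : 5 ≤ p) {μ ν : ℕ} (h : α.IsSon μ ν) : 1 < ν :=
  h.1.trans_lt (h.lt hp)

/-- Fathers depend monotonically on their sons, so removing the last edge of both paths keeps their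
endpoints in order. -/
theorem pathOfLength_le (α : Assignment p) (hp : 5 ≤ p) {j k μ ν : ℕ}
    (hj : PathOfLength α.IsSon j 1 μ) (hk : PathOfLength α.IsSon k 1 ν) (h : μ ≤ ν) :
    j ≤ k := by
  induction k generalizing j μ ν with
  | zero =>
    cases j with
    | zero => exact le_rfl
    | succ j =>
      obtain ⟨κ, -, h2⟩ := hj
      have := α.one_lt_of_isSon hp h2
      obtain rfl : 1 = ν := hk
      omega
  | succ k ih =>
    cases j with
    | zero => exact Nat.zero_le _
    | succ j =>
      obtain ⟨κ, h1, h2⟩ := hj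
      obtain ⟨η, h3, h4⟩ := hk
      exact Nat.succ_le_succ (ih h1 h3 (h2.father_le hp h4 h))

theorem level_mono (α : Assignment p) (hp : 5 ≤ p) {μ ν : ℕ} (hμ : 1 ≤ μ) (h : μ ≤ ν) :
    α.whiteTree.level μ ≤ α.whiteTree.level ν :=
  α.pathOfLength_le hp (Nat.sInf_mem (s := {k | PathOfLength α.IsSon k 1 μ}) (α.reachable hp hμ))
    (Nat.sInf_mem (s := {k | PathOfLength α.IsSon k 1 ν}) (α.reachable hp (hμ.trans h))) h

/-- Since levels are monotone in the integers, the nodes counted up to `ν` are exactly `1, …, ν`. -/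
theorem number_whiteTree (α : Assignment p) (hp : 5 ≤ p) {ν : ℕ} (hν : 1 ≤ ν) :
    α.whiteTree.number ν = ν := by
  have : {μ | μ ∈ α.whiteTree.nodes ∧ (α.whiteTree.level μ < α.whiteTree.level ν ∨
      (α.whiteTree.level μ = α.whiteTree.level ν ∧ μ ≤ ν))} = Finset.Icc 1 ν := by
    ext μ
    rw [Finset.coe_Icc]
    constructor
    · rintro ⟨h1, h2⟩
      refine ⟨h1, ?_⟩
      by_contra! h
      have := α.level_mono hp hν h.le
      omega
    · rintro ⟨h1, h2⟩
      exact ⟨h1, (α.level_mono hp h1 h2).lt_or_eq.imp id fun h => ⟨h, h2⟩⟩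
  rw [OrderedTree.number, this, Set.ncard_coe_finset]
  simp

theorem image_number_sons (α : Assignment p) (hp : 5 ≤ p) (ν : ℕ) :
    α.whiteTree.number '' α.whiteTree.sons ν = α.whiteTree.sons ν := by
  have h : Set.EqOn α.whiteTree.number id (α.whiteTree.sons ν) := fun κ hκ =>
    α.number_whiteTree hp (α.one_lt_of_isSon hp (show α.IsSon ν κ from hκ)).le
  rw [h.image_eq, Set.image_id]

theorem ncard_sons_whiteTree (α : Assignment p) {ν : ℕ} (hν : 1 ≤ ν) :
    (α.whiteTree.sons ν).ncard = p - 2 - α.s ν := by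
  rw [α.whiteTree_sons hν, ← Finset.coe_Ico, Set.ncard_coe_finset]
  simp

theorem isNumberedTree_whiteTree (α : Assignment p) (hp : 5 ≤ p) :
    α.whiteTree.IsNumberedTree where
  infinite := Set.Ici_infinite 1
  root_mem := le_refl 1
  son_mem μ ν h := ⟨h.1, (α.one_lt_of_isSon hp h).le⟩
  root_not_son μ h := lt_irrefl 1 (α.one_lt_of_isSon hp h)
  existsUnique_father ν hν hne := by
    obtain ⟨μ, hμ⟩ := α.exists_father hp (lt_of_le_of_ne hν (Ne.symm hne))
    exact ⟨μ, hμ, fun μ' hμ' => (IsSon.eq_father hp hμ').symm.trans (hμ.eq_father hp)⟩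
  reachable ν hν := α.reachable hp hν
  finite_sons ν hν := by
    rw [α.whiteTree_sons hν]
    exact Set.finite_Ico _ _
  planar μ hμ ν hν _ hlt κ hκ η hη :=
    (α.isSon_iff.1 hκ).2.2.trans_le ((α.l_mono hp (Nat.le_add_left 1 μ) hlt).trans hη.2.1)
  consecutive ν hν :=
    ⟨α.l ν, by rw [α.image_number_sons hp, α.ncard_sons_whiteTree hν, α.whiteTree_sons hν]⟩

theorem black_unique (α : Assignment p) {ν : ℕ} (hν : 1 ≤ ν) {β : ℕ} (hβ : α.IsSon ν β)
    (h : α.s β = 1) : β = α.l ν + α.b ν - 1 := by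
  have hb := α.b_mem ν hν
  have hs := α.s_black ν hν
  have hsum := α.sum_s ν hν
  have hl := α.l_succ ν hν
  by_contra hne
  -- Two distinct black sons would already contribute `2` to the sum of statuses.
  have h1 : ∑ κ ∈ {β, α.l ν + α.b ν - 1}, α.s κ ≤ 1 := by
    rw [← hsum]
    refine Finset.sum_le_sum_of_subset ?_
    intro κ hκ
    have := hβ.2
    rw [Finset.mem_insert, Finset.mem_singleton] at hκ
    rw [Finset.mem_Ico]
    omega
  rw [Finset.sum_pair hne, h, hs] at h1
  omega

theorem carries_whiteTree (α : Assignment p) (hp : 5 ≤ p) :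
    α.whiteTree.Carries α.s α where
  status ν hν := by rw [α.number_whiteTree hp hν]
  leftmost ν hν := by
    rw [α.image_number_sons hp, α.number_whiteTree hp hν, α.whiteTree_sons hν]
    have := α.s_le_one hν
    exact isLeast_Ico (by omega)
  ncard_sons ν hν := by rw [α.number_whiteTree hp hν, α.ncard_sons_whiteTree hν]
  existsUnique_black ν hν := by
    have hb := α.b_mem ν hν
    exact ⟨α.l ν + α.b ν - 1, ⟨⟨hν, by omega, by omega⟩, α.s_black ν hν⟩,
      fun β hβ => α.black_unique hν hβ.1 hβ.2⟩
  black_position ν hν β hβ hs := by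
    have hb := α.b_mem ν hν
    have hβ' := α.black_unique hν hβ hs
    have : {κ | κ ∈ α.whiteTree.sons ν ∧ κ ≤ β} = Finset.Icc (α.l ν) β := by
      ext κ
      rw [α.whiteTree_sons hν, Finset.coe_Icc]
      simp only [Set.mem_ofPred_eq, Set.mem_Ico, Set.mem_Icc]
      omega
    rw [this, Set.ncard_coe_finset, Nat.card_Icc, α.number_whiteTree hp hν]
    omega

/-! ### The tree of the `0`-nodes -/

theorem zeroTree_isSon_iff (α : Assignment p) (hp : 5 ≤ p) {τ τ' : ℕ} (hτ : τ ∈ zeroNodes p)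
    (hτ' : τ' ∈ zeroNodes p) : α.zeroTree.IsSon τ τ' ↔ α.IsSon (phi p τ) (phi p τ') := by
  have h1 := (α.father_eq_phi hp hτ).2
  have h2 := α.father_eq_phi hp hτ'
  constructor
  -- The middle node of the path is the father of `τ'`, that is `phi p τ'`, and the path starts at
  -- `phi p τ`.
  · rintro ⟨-, -, κ, ⟨κ', rfl, h3⟩, h4⟩
    rwa [h1, ← h4.eq_father hp, h2.2] at h3
  · intro h
    exact ⟨hτ, hτ', phi p τ', ⟨phi p τ, h1, h⟩, h2.1⟩

theorem value_one_zero (hp : 5 ≤ p) : value p [0, 1] = zeroNode p 1 := by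
  rw [zeroNode, code_one hp]

theorem isMonotoneIso_phi (α : Assignment p) (hp : 5 ≤ p) :
    OrderedTree.IsMonotoneIso (phi p) α.zeroTree α.whiteTree where
  bijOn := phi_bijOn hp
  strictMonoOn := phi_strictMonoOn hp
  root_mem := by
    show value p [0, 1] ∈ zeroNodes p
    rw [value_one_zero hp]
    exact zeroNode_mem hp le_rfl
  map_root := by
    show phi p (value p [0, 1]) = 1
    rw [value_one_zero hp, phi_zeroNode hp le_rfl]
  son_mem _ _ h := ⟨h.1, h.2.1⟩
  son_mem' := (α.isNumberedTree_whiteTree hp).son_mem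
  isSon_iff _ hτ _ hτ' := α.zeroTree_isSon_iff hp hτ hτ'

end Assignment

end Metallic

theorem mainTheorem8 (p : ℕ) (hp : 5 ≤ p) (α : Metallic.Assignment p) :
    -- the map `[ν]0 ↦ ν` is a bijection from the `0`-nodes onto the nodes of the white tree
    Set.BijOn (Metallic.phi p) (Metallic.zeroNodes p) {ν : ℕ | 1 ≤ ν} ∧
    (∀ τ ∈ Metallic.zeroNodes p,
      Metallic.code p τ = 0 :: Metallic.code p (Metallic.phi p τ)) ∧
    -- the father of the `0`-node `[ν]0` is `ν`
    (∀ τ ∈ Metallic.zeroNodes p,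
      α.IsSon (Metallic.phi p τ) τ ∧ α.father τ = Metallic.phi p τ) ∧
    -- both trees are numbered trees, and the numbers of the white tree are the natural ones
    α.whiteTree.IsNumberedTree ∧
    (∀ ν : ℕ, 1 ≤ ν → α.whiteTree.number ν = ν) ∧
    α.zeroTree.IsNumberedTree ∧
    -- the bijection is an isomorphism of trees
    Metallic.OrderedTree.IsIso (Metallic.phi p) α.zeroTree α.whiteTree ∧
    -- it transports the statuses, and the assignment
    (∀ τ ∈ Metallic.zeroNodes p, α.zeroStatus τ = α.s (Metallic.phi p τ)) ∧
    α.whiteTree.Carries α.s α ∧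
    α.zeroTree.Carries α.zeroStatus α := by
  have iso := α.isMonotoneIso_phi hp
  have hst : ∀ τ ∈ Metallic.zeroNodes p, α.zeroStatus τ = α.s (Metallic.phi p τ) := fun τ hτ => by
    rw [Metallic.Assignment.zeroStatus, (α.father_eq_phi hp hτ).2]
  have white := α.isNumberedTree_whiteTree hp
  have carries := α.carries_whiteTree hp
  exact ⟨Metallic.phi_bijOn hp, fun τ hτ => Metallic.code_eq_zero_cons hp hτ,
    fun τ hτ => α.father_eq_phi hp hτ, white, fun ν hν => α.number_whiteTree hp hν,
    iso.isNumberedTree white, iso.isIso, hst, carries, iso.carries hst carries⟩
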